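/- Let $\mathsf M$ be the pseudovariety of all finite monoids and, for a finite set $A$, let $\overline{\Omega}_A\mathsf M$ be the free profinite monoid over $A$, that is, the inverse limit of the finite $A$-generated monoids. A pseudoidentity $u=v$ over $A$ is a pair of elements of $\overline{\Omega}_A\mathsf M$; it holds in a finite monoid $T$ if $\psi(u)=\psi(v)$ for every continuous homomorphism $\psi:\overline{\Omega}_A\mathsf M\to T$. For a set $\Sigma$ of pseudoidentities (over finite sets), let $[\![\Sigma]\!]$ be the class of all finite monoids in which all members of $\Sigma$ hold. For a finite set $A$, define binary relations $\Sigma_\alpha$ on $\overline{\Omega}_A\mathsf M$, for all ordinals $\alpha$, as follows: $\Sigma_0$ consists of all pairs $(\mathbf t(\varphi(u),w_1,\dots,w_n),\mathbf t(\varphi(v),w_1,\dots,w_n))$ where $u=v$ or $v=u$ is in $\Sigma$, with $u,v\in\overline{\Omega}_B\mathsf M$, $\varphi:\overline{\Omega}_B\mathsf M\to\overline{\Omega}_A\mathsf M$ is a continuous homomorphism, $\mathbf t$ is a monoid term, and $w_1,\dots,w_n\in\overline{\Omega}_A\mathsf M$; $\Sigma_{2\alpha+1}$ is the transitive closure of $\Sigma_{2\alpha}$;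 $\Sigma_{2\alpha+2}$ is the topological closure of $\Sigma_{2\alpha+1}$; and $\Sigma_\alpha=\bigcup_{\beta<\alpha}\Sigma_\beta$ if $\alpha$ is a limit ordinal. A pseudoidentity $u=v$ over $A$ is provable from $\Sigma$ if $(u,v)\in\bigcup_\alpha\Sigma_\alpha$. The set $\Sigma$ is h-strong (within $\mathsf M$) if every pseudoidentity over a finite set that holds in all members of $[\![\Sigma]\!]$ is provable from $\Sigma$. As usual, $u^\omega=\lim u^{n!}$ and $u^{\omega+1}=u^\omega u$. Theorem. The sets of pseudoidentities $$\Sigma=\{x^{\omega+1}=x^\omega,\ (xy)^\omega=(yx)^\omega\}\quad\text{and}\quad \Gamma=\{(xy)^\omega x=(xy)^\omega=y(xy)^\omega\}$$ are both bases of the pseudovariety $\mathsf J$ of all finite $\mathcal J$-trivial monoids, that is, $[\![\Sigma]\!]=[\![\Gamma]\!]=\mathsf J$, and both are h-strong. -/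

import Mathlib

open Filter Topology

/-! ## Finite monoids: the idempotent power, `J`-triviality -/

/-- Every element of a finite monoid has an idempotent power with positive exponent. -/
theorem exists_pow_idempotent {S : Type} [Monoid S] [Finite S] (s : S) :
    ∃ n : ℕ, 0 < n ∧ IsIdempotentElem (s ^ n) := by
  obtain ⟨i, j, hij, h⟩ := Finite.exists_ne_map_eq_of_infinite (fun n : ℕ => s ^ n)
  wlog hlt : i < j generalizing i j
  · exact this j i hij.symm h.symm (by omega)
  obtain ⟨p, hp, rfl⟩ : ∃ p, 0 < p ∧ j = i + p := ⟨j - i, by omega, by omega⟩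
  have h1 : ∀ m k : ℕ, i ≤ m → s ^ (m + k * p) = s ^ m := by
    intro m k hm
    obtain ⟨d, rfl⟩ := Nat.exists_eq_add_of_le hm
    induction k with
    | zero => simp
    | succ k ih =>
      have h' : s ^ i = s ^ (i + p) := h
      calc s ^ (i + d + (k + 1) * p) = s ^ (i + p) * s ^ (d + k * p) := by
            rw [← pow_add]; congr 1; ring
        _ = s ^ i * s ^ (d + k * p) := by rw [← h']
        _ = s ^ (i + d + k * p) := by rw [← pow_add]; congr 1; ring
        _ = s ^ (i + d) := ih
  refine ⟨(i + 1) * p, by positivity, ?_⟩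
  have h2 : i ≤ (i + 1) * p := by nlinarith
  show s ^ ((i + 1) * p) * s ^ ((i + 1) * p) = s ^ ((i + 1) * p)
  rw [← pow_add]
  exact h1 _ _ h2

/-- For an element `s` of a finite monoid, `s^ω` is the (unique) idempotent among the powers
`s^n` with `n ≥ 1`. -/
noncomputable def omegaPow {S : Type} [Monoid S] [Finite S] (s : S) : S :=
  s ^ (exists_pow_idempotent s).choose

theorem omegaPow_eq_of_idempotent {S : Type} [Monoid S] [Finite S] (s : S) {n : ℕ}
    (hn : 0 < n) (h : IsIdempotentElem (s ^ n)) : omegaPow s = s ^ n := by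
  obtain ⟨hk, he⟩ := (exists_pow_idempotent s).choose_spec
  unfold omegaPow
  set k := (exists_pow_idempotent s).choose
  rw [← he.pow_eq hn.ne', ← pow_mul, mul_comm, pow_mul, h.pow_eq hk.ne']

theorem map_omegaPow {S T : Type} [Monoid S] [Finite S] [Monoid T] [Finite T] (f : S →* T)
    (s : S) : f (omegaPow s) = omegaPow (f s) := by
  obtain ⟨hk, he⟩ := (exists_pow_idempotent s).choose_spec
  have h : IsIdempotentElem (f s ^ (exists_pow_idempotent s).choose) := by
    rw [← map_pow]; exact he.map f
  rw [omegaPow_eq_of_idempotent (f s) hk h, ← map_pow]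
  rfl

/-- `a ≤_J b`: the element `a` lies in the two-sided ideal generated by `b`. -/
def JBelow {S : Type} [Monoid S] (a b : S) : Prop :=
  ∃ x y : S, a = x * b * y

/-- A monoid is `J`-trivial if any two elements generating the same two-sided ideal are equal. -/
def IsJTrivial (S : Type) [Monoid S] : Prop :=
  ∀ a b : S, JBelow a b → JBelow b a → a = b

/-! ## The free profinite monoid over a set `A` -/

/-- The congruences of finite index on the free monoid over `A`. Their quotients represent all
the finite `A`-generated monoids. -/
abbrev FinCon (A : Type) : Type :=
  {c : Con (FreeMonoid A) // Finite c.Quotient}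

instance (A : Type) (c : FinCon A) : Finite c.1.Quotient := c.2

/-- The free profinite monoid over `A`: the inverse limit of the finite `A`-generated monoids,
realized as the monoid of compatible families in their product. -/
def freeProfiniteSubmonoid (A : Type) : Submonoid (∀ c : FinCon A, c.1.Quotient) where
  carrier := {f | ∀ (c d : FinCon A) (h : c.1 ≤ d.1), Con.map c.1 d.1 h (f c) = f d}
  one_mem' := by intro c d h; simp
  mul_mem' := by
    intro f g hf hg c d h
    simp [hf c d h, hg c d h]

/-- The type of pseudowords over `A`. -/
def Pseudoword (A : Type) : Type := freeProfiniteSubmonoid A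

namespace Pseudoword

noncomputable instance (A : Type) : Monoid (Pseudoword A) :=
  inferInstanceAs (Monoid (freeProfiniteSubmonoid A))

/-- The inverse limit topology, the finite monoids being discrete. -/
instance (A : Type) : TopologicalSpace (Pseudoword A) :=
  TopologicalSpace.induced (fun u : Pseudoword A => u.1)
    (@Pi.topologicalSpace (FinCon A) (fun c => c.1.Quotient) (fun _ => ⊥))

/-- The projection of a pseudoword onto a finite `A`-generated monoid. -/
noncomputable def proj {A : Type} (c : FinCon A) : Pseudoword A →* c.1.Quotient :=
  (Pi.evalMonoidHom (fun c : FinCon A => c.1.Quotient) c).comp (freeProfiniteSubmonoid A).subtype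

/-- The free generators. -/
def of {A : Type} (a : A) : Pseudoword A :=
  ⟨fun c => Con.mk' c.1 (FreeMonoid.of a), fun _ _ _ => rfl⟩

/-- The pseudoword `u^ω`, computed in each finite quotient. -/
noncomputable def omega {A : Type} (u : Pseudoword A) : Pseudoword A :=
  ⟨fun c => omegaPow (u.1 c), fun c d h => by rw [map_omegaPow, u.2 c d h]⟩

/-- The kernel of the homomorphism from the free monoid to a finite monoid `T` that extends
`φ : A → T`. -/
def kerFin {A T : Type} [Monoid T] [Finite T] (φ : A → T) : FinCon A :=
  ⟨Con.ker (FreeMonoid.lift φ), Finite.of_injective _ (Con.kerLift_injective _)⟩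

/-- The continuous homomorphism from the free profinite monoid to a finite monoid `T` that
extends `φ : A → T`. Its value at `w` is the value `w_T(φ)` of the implicit operation `w`. -/
noncomputable def eval {A T : Type} [Monoid T] [Finite T] (φ : A → T) : Pseudoword A →* T :=
  (Con.kerLift (FreeMonoid.lift φ)).comp (proj (kerFin φ))

theorem eval_of {A T : Type} [Monoid T] [Finite T] (φ : A → T) (a : A) :
    eval φ (of a) = φ a := by
  show Con.kerLift (FreeMonoid.lift φ) (Con.mk' _ (FreeMonoid.of a)) = φ a
  simp

end Pseudoword

/-! ## Pseudoidentities and the finite monoids that they define -/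

/-- A pseudoidentity `lhs = rhs` over a finite alphabet, for the pseudovariety of all finite
monoids. -/
structure Pseudoidentity where
  alphabet : Type
  finite_alphabet : Finite alphabet
  lhs : Pseudoword alphabet
  rhs : Pseudoword alphabet

/-- The pseudoidentity `u = v` holds in the finite monoid `T`. -/
def HoldsIn (T : Type) [Monoid T] [Finite T] {A : Type} (u v : Pseudoword A) : Prop :=
  ∀ φ : A → T, Pseudoword.eval φ u = Pseudoword.eval φ v

/-- The finite monoid `T` belongs to the pseudovariety defined by `Σ`. -/
def Models (T : Type) [Monoid T] [Finite T] (S : Set Pseudoidentity) : Prop :=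
  ∀ p ∈ S, HoldsIn T p.lhs p.rhs

/-! ## The proof scheme -/

/-- Terms in the algebraic signature of monoids over a set `X` of variables. -/
inductive MonoidTerm (X : Type) : Type
  | var : X → MonoidTerm X
  | one : MonoidTerm X
  | mul : MonoidTerm X → MonoidTerm X → MonoidTerm X

/-- The value of a term in a monoid. -/
def MonoidTerm.eval {X M : Type} [Monoid M] (f : X → M) : MonoidTerm X → M
  | var x => f x
  | one => 1
  | mul s t => s.eval f * t.eval f

/-- The pairs `(t(φ(u), w₁, …, wₙ), t(φ(v), w₁, …, wₙ))` where `u = v` or `v = u` belongs to the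
given set, `φ` is a continuous homomorphism, `t` is a term, and the `wᵢ` are pseudowords. -/
def baseStep (S : Set Pseudoidentity) (A : Type) : Set (Pseudoword A × Pseudoword A) :=
  {q | ∃ p ∈ S, ∃ u v : Pseudoword p.alphabet,
    ((u = p.lhs ∧ v = p.rhs) ∨ (u = p.rhs ∧ v = p.lhs)) ∧
    ∃ φ : Pseudoword p.alphabet →* Pseudoword A, Continuous φ ∧
    ∃ (n : ℕ) (t : MonoidTerm (Fin (n + 1))) (w : Fin n → Pseudoword A),
      q = (t.eval (Fin.cons (φ u) w), t.eval (Fin.cons (φ v) w))}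

/-- The transitive closure of a binary relation given as a set of pairs. -/
def transClosure {X : Type} (R : Set (X × X)) : Set (X × X) :=
  {q | Relation.TransGen (fun x y => (x, y) ∈ R) q.1 q.2}

open Classical in
/-- The transfinite sequence `Σ_α`: it starts with `baseStep`, passes from `Σ_{2α}` to
`Σ_{2α+1}` by transitive closure and from `Σ_{2α+1}` to `Σ_{2α+2}` by topological closure, and
takes unions at limit ordinals. -/
noncomputable def stage (S : Set Pseudoidentity) (A : Type) (α : Ordinal.{0}) :
    Set (Pseudoword A × Pseudoword A) :=
  Ordinal.limitRecOn (motive := fun _ => Set (Pseudoword A × Pseudoword A)) α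
    (baseStep S A)
    (fun β R => if 2 ∣ β then transClosure R else closure R)
    (fun β _ R => ⋃ (γ : Ordinal.{0}) (h : γ < β), R γ h)

theorem stage_zero (S : Set Pseudoidentity) (A : Type) : stage S A 0 = baseStep S A :=
  Ordinal.limitRecOn_zero ..

theorem stage_odd (S : Set Pseudoidentity) (A : Type) (α : Ordinal.{0}) :
    stage S A (2 * α + 1) = transClosure (stage S A (2 * α)) := by
  unfold stage
  rw [Ordinal.limitRecOn_add_one, if_pos (Dvd.intro _ rfl)]

theorem stage_even (S : Set Pseudoidentity) (A : Type) (α : Ordinal.{0}) :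
    stage S A (2 * α + 2) = closure (stage S A (2 * α + 1)) := by
  have h : ¬ (2 : Ordinal.{0}) ∣ 2 * α + 1 := by
    intro h
    have h1 : (2 : Ordinal.{0}) ∣ 1 := (Ordinal.dvd_add_iff (Dvd.intro _ rfl)).1 h
    have h2 := Ordinal.le_of_dvd one_ne_zero h1
    exact absurd h2 (by simp)
  have e : (2 * α + 2 : Ordinal.{0}) = 2 * α + 1 + 1 := by
    rw [add_assoc, one_add_one_eq_two]
  rw [e]
  unfold stage
  rw [Ordinal.limitRecOn_add_one, if_neg h]

theorem stage_limit (S : Set Pseudoidentity) (A : Type) (α : Ordinal.{0})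
    (h : Order.IsSuccLimit α) :
    stage S A α = ⋃ (β : Ordinal.{0}) (_ : β < α), stage S A β := by
  unfold stage
  rw [Ordinal.limitRecOn_limit _ _ _ _ h]

/-- The pseudoidentity `u = v` is provable from the given set of pseudoidentities: it appears at
some stage of the transfinite sequence. -/
def Provable (S : Set Pseudoidentity) {A : Type} (u v : Pseudoword A) : Prop :=
  ∃ α : Ordinal.{0}, (u, v) ∈ stage S A α

/-- A set of pseudoidentities is h-strong, within the pseudovariety of all finite monoids, if it
proves every pseudoidentity (over any finite alphabet) that holds in all the finite monoids
satisfying the set. -/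
def HStrong (S : Set Pseudoidentity) : Prop :=
  ∀ (A : Type) [Finite A] (u v : Pseudoword A),
    (∀ (T : Type) [Monoid T] [Finite T], Models T S → HoldsIn T u v) → Provable S u v

/-! ## The two sets of pseudoidentities -/

/-- The letter `x` of the two-letter alphabet. -/
def letterX : Pseudoword (Fin 2) := Pseudoword.of 0

/-- The letter `y` of the two-letter alphabet. -/
def letterY : Pseudoword (Fin 2) := Pseudoword.of 1

/-- The pseudoidentity `u = v` over the alphabet `{x, y}`. -/
abbrev pseudoidXY (u v : Pseudoword (Fin 2)) : Pseudoidentity :=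
  ⟨Fin 2, inferInstance, u, v⟩

/-- The set `{x^{ω+1} = x^ω, (xy)^ω = (yx)^ω}`; the first is a one-variable pseudoidentity. -/
noncomputable def sigmaJ : Set Pseudoidentity :=
  {⟨Fin 1, inferInstance, (Pseudoword.of 0).omega * Pseudoword.of 0, (Pseudoword.of 0).omega⟩,
    pseudoidXY (letterX * letterY).omega (letterY * letterX).omega}

/-- The set `{(xy)^ω x = (xy)^ω = y (xy)^ω}`, that is, two pseudoidentities. -/
noncomputable def gammaJ : Set Pseudoidentity :=
  {pseudoidXY ((letterX * letterY).omega * letterX) (letterX * letterY).omega,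
    pseudoidXY (letterX * letterY).omega (letterY * (letterX * letterY).omega)}

/-! Both sets define `J` because, in a finite monoid, `J`-triviality amounts to the absorption laws
`(xy)^ω x = (xy)^ω = y (xy)^ω`, and these follow from `Σ` by a collapse of groups
(`rel_omega_mul_left`) valid modulo any closed congruence.

For h-strength, provability is a closed congruence `R` on pseudowords, containing all substitution
instances of the given set. If `(u, v)` is not in `R`, a finite model separating `u` from `v` is
needed. The crucial point is that the absorption laws make the quotient by `R` countable
(`countable_quotient`): every pseudoword is `R`-equivalent to a product of letters and `ω`-powers of
words. Indeed, a limit of words with ever more consecutive factors of full content `B` collapses to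
one `ω`-power, and any other limit of words over `B` factors into finitely many letters and limits
over smaller alphabets.

A countable compact Hausdorff space is zero-dimensional, so some `R`-saturated clopen set contains
`u` and not `v`. Its syntactic monoid is finite, as clopen sets are recognized by finite quotients,
and is a quotient by a congruence containing `R`; hence it is a model in which `u` and `v` differ
(`rel_of_forall_models`). -/

/-! ## A separation property of countable quotients of compact spaces -/

/-- If a closed equivalence relation on a compact Hausdorff space has countably many classes,
then any two classes are separated by a saturated clopen set. -/
theorem exists_isClopen_saturated {X : Type*} [TopologicalSpace X] [CompactSpace X] [T2Space X]
    (r : Setoid X) (hr : IsClosed {p : X × X | r p.1 p.2}) [Countable (Quotient r)] {u v : X}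
    (h : ¬ r u v) :
    ∃ U : Set X, IsClopen U ∧ (∀ x y, r x y → x ∈ U → y ∈ U) ∧ u ∈ U ∧ v ∉ U := by
  let π : X → Quotient r := Quotient.mk r
  have hπc : Continuous π := continuous_quotient_mk'
  have hπe : ∀ x y, π x = π y ↔ r x y := fun x y => Quotient.eq
  have hπs : Function.Surjective π := Quotient.mk_surjective
  have hclosed : IsClosedMap π := by
    intro C hC
    -- The saturation of `C` is the second projection of a compact part of the graph of `r`, hence
    -- closed.
    have e : π ⁻¹' (π '' C) = Prod.snd '' ({p : X × X | r p.1 p.2} ∩ Prod.fst ⁻¹' C) := by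
      ext y
      constructor
      · rintro ⟨x, hx, hxy⟩
        exact ⟨(x, y), ⟨(hπe x y).1 hxy, hx⟩, rfl⟩
      · rintro ⟨⟨x, y⟩, ⟨hxy, hx⟩, rfl⟩
        exact ⟨x, hx, (hπe x y).2 hxy⟩
    have hq : IsQuotientMap π := isQuotientMap_quotient_mk'
    rw [← hq.isClosed_preimage, e]
    exact ((hr.inter (hC.preimage continuous_fst)).isCompact.image continuous_snd).isClosed
  have hsing : ∀ q : Quotient r, IsClosed ({q} : Set (Quotient r)) := by
    intro q
    obtain ⟨x, rfl⟩ := hπs q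
    simpa using hclosed {x} isClosed_singleton
  -- Normality passes along the closed surjection `π`: separate the preimages in `X` and take
  -- complements of images of complements.
  have : NormalSpace (Quotient r) := by
    refine ⟨fun C D hC hD hCD => ?_⟩
    obtain ⟨U, V, hU, hV, hCU, hDV, hUV⟩ := normal_separation (hC.preimage hπc)
      (hD.preimage hπc) (hCD.preimage π)
    refine ⟨(π '' Uᶜ)ᶜ, (π '' Vᶜ)ᶜ, (hclosed _ hU.isClosed_compl).isOpen_compl,
      (hclosed _ hV.isClosed_compl).isOpen_compl, ?_, ?_, ?_⟩
    · rintro q hq ⟨x, hx, rfl⟩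
      exact hx (hCU hq)
    · rintro q hq ⟨x, hx, rfl⟩
      exact hx (hDV hq)
    · rw [Set.disjoint_left]
      intro q h1 h2
      obtain ⟨x, rfl⟩ := hπs q
      have hxU : x ∈ U := by
        by_contra hx
        exact h1 ⟨x, hx, rfl⟩
      have hxV : x ∈ V := by
        by_contra hx
        exact h2 ⟨x, hx, rfl⟩
      exact Set.disjoint_left.1 hUV hxU hxV
  have hdisj : Disjoint ({π u} : Set (Quotient r)) {π v} := by
    rw [Set.disjoint_singleton]
    exact fun e => h ((hπe u v).1 e)
  obtain ⟨f, hf0, hf1, -⟩ := exists_continuous_zero_one_of_isClosed (hsing (π u)) (hsing (π v))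
    hdisj
  have hfu : f (π u) = 0 := hf0 rfl
  have hfv : f (π v) = 1 := hf1 rfl
  -- An Urysohn function takes countably many values on a countable space, so it omits some `t` in
  -- `(0, 1)`; its sublevel set at `t` is then both open and closed.
  obtain ⟨t, ht, htr⟩ : ∃ t ∈ Set.Ioo (0 : ℝ) 1, t ∉ Set.range f := by
    by_contra! hcon
    have hcount : (Set.Ioo (0 : ℝ) 1).Countable :=
      (Set.countable_range f).mono fun t ht => hcon t ht
    have h1 := hcount.le_aleph0
    rw [Cardinal.mk_Ioo_real one_pos] at h1
    exact absurd h1 (not_le.2 Cardinal.aleph0_lt_continuum)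
  have hcont : Continuous fun x => f (π x) := f.continuous.comp hπc
  refine ⟨{x | f (π x) < t}, ⟨?_, isOpen_lt hcont continuous_const⟩, ?_, ?_, ?_⟩
  · have e : {x | f (π x) < t} = {x | f (π x) ≤ t} := by
      ext x
      exact ⟨fun hx => le_of_lt (b := t) hx, fun hx => lt_of_le_of_ne hx fun e => htr ⟨_, e⟩⟩
    rw [e]
    exact isClosed_le hcont continuous_const
  · intro x y hxy hx
    have : π x = π y := (hπe x y).2 hxy
    simpa [this] using hx
  · simpa [hfu] using ht.1
  · simpa [hfv] using ht.2.le

/-! ## Finite monoids -/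

/-- Finitely many elements of finite monoids have a common exponent that computes `ω`. -/
theorem exists_omegaPow_eq_pow {S T : Type} [Monoid S] [Finite S] [Monoid T] [Finite T]
    (s : S) (t : T) : ∃ n : ℕ, 0 < n ∧ omegaPow s = s ^ n ∧ omegaPow t = t ^ n := by
  obtain ⟨m, hm, h⟩ := exists_pow_idempotent s
  obtain ⟨k, hk, h'⟩ := exists_pow_idempotent t
  refine ⟨m * k, Nat.mul_pos hm hk, omegaPow_eq_of_idempotent s (Nat.mul_pos hm hk) ?_,
    omegaPow_eq_of_idempotent t (Nat.mul_pos hm hk) ?_⟩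
  · rw [pow_mul, h.pow_eq hk.ne']
    exact h
  · rw [mul_comm, pow_mul, h'.pow_eq hm.ne']
    exact h'

theorem isIdempotentElem_omegaPow {S : Type} [Monoid S] [Finite S] (s : S) :
    IsIdempotentElem (omegaPow s) :=
  (exists_pow_idempotent s).choose_spec.2

/-- With a common exponent `n` for both `ω`-powers, this is `(st)^n s = s (ts)^n`. -/
theorem omegaPow_mul_swap {S : Type} [Monoid S] [Finite S] (s t : S) :
    omegaPow (s * t) * s = s * omegaPow (t * s) := by
  obtain ⟨n, -, h1, h2⟩ := exists_omegaPow_eq_pow (s * t) (t * s)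
  rw [h1, h2]
  clear h1 h2
  induction n with
  | zero => simp
  | succ n ih => rw [pow_succ', mul_assoc, ih, pow_succ']; simp only [mul_assoc]

/-- The extra factor can be undone by completing it to a power of `xy`, which the idempotent
`(xy)^ω` absorbs; so the elements compared are `J`-equivalent. -/
theorem omegaPow_absorb_of_isJTrivial {T : Type} [Monoid T] [Finite T] (h : IsJTrivial T)
    (x y : T) : omegaPow (x * y) * x = omegaPow (x * y) ∧
      omegaPow (x * y) = y * omegaPow (x * y) := by
  obtain ⟨n, hn, he, -⟩ := exists_omegaPow_eq_pow (x * y) (x * y)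
  have hi := isIdempotentElem_omegaPow (x * y)
  obtain ⟨n, rfl⟩ := Nat.exists_eq_succ_of_ne_zero hn.ne'
  constructor
  · refine h _ _ ⟨1, x, by simp⟩ ⟨1, y * (x * y) ^ n, ?_⟩
    calc omegaPow (x * y) = omegaPow (x * y) * (x * y) ^ (n + 1) := by
          rw [← Nat.succ_eq_add_one, ← he]; exact hi.symm
      _ = _ := by rw [pow_succ']; simp only [mul_assoc, one_mul]
  · refine h _ _ ⟨(x * y) ^ n * x, 1, ?_⟩ ⟨y, 1, by simp⟩
    calc omegaPow (x * y) = (x * y) ^ (n + 1) * omegaPow (x * y) := by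
          rw [← Nat.succ_eq_add_one, ← he]; exact hi.symm
      _ = _ := by rw [pow_succ]; simp only [mul_assoc, mul_one]

/-- From `a = xby` and `b = zaw`, iteration gives `a = (xz)^ω a (wy)^ω`. The left idempotent absorbs
`z` and the right one absorbs `w`, so `a = zaw = b`. -/
theorem isJTrivial_of_omegaPow_absorb {T : Type} [Monoid T] [Finite T]
    (h : ∀ x y : T, omegaPow (x * y) * x = omegaPow (x * y) ∧
      omegaPow (x * y) = y * omegaPow (x * y)) : IsJTrivial T := by
  rintro a b ⟨x, y, hab⟩ ⟨z, w, hba⟩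
  have h1 : ∀ n : ℕ, a = (x * z) ^ n * a * (w * y) ^ n := by
    intro n
    induction n with
    | zero => simp
    | succ n ih =>
      calc a = x * (z * a * w) * y := by rw [← hba, ← hab]
        _ = (x * z) * a * (w * y) := by simp only [mul_assoc]
        _ = (x * z) * ((x * z) ^ n * a * (w * y) ^ n) * (w * y) := by rw [← ih]
        _ = _ := by rw [pow_succ', pow_succ]; simp only [mul_assoc]
  obtain ⟨n, -, he, hf⟩ := exists_omegaPow_eq_pow (x * z) (w * y)
  have h2 := h1 n
  rw [← he, ← hf] at h2
  calc a = omegaPow (x * z) * a * omegaPow (w * y) := h2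
    _ = z * omegaPow (x * z) * a * (omegaPow (w * y) * w) := by
        rw [(h w y).1, ← (h x z).2]
    _ = z * (omegaPow (x * z) * a * omegaPow (w * y)) * w := by simp only [mul_assoc]
    _ = b := by rw [← h2, ← hba]

/-! ## The topological monoid of pseudowords -/

namespace Pseudoword

variable {A : Type}

theorem ext_proj {u v : Pseudoword A} (h : ∀ c, proj c u = proj c v) : u = v :=
  Subtype.ext (funext h)

theorem map_proj {c d : FinCon A} (h : c.1 ≤ d.1) (u : Pseudoword A) :
    Con.map c.1 d.1 h (proj c u) = proj d u :=
  u.2 c d h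

theorem proj_eq_of_le {c d : FinCon A} (h : c.1 ≤ d.1) {u v : Pseudoword A}
    (huv : proj c u = proj c v) : proj d u = proj d v := by
  rw [← map_proj h, huv, map_proj h]

theorem proj_omega (c : FinCon A) (u : Pseudoword A) : proj c u.omega = omegaPow (proj c u) :=
  rfl

/-- The pseudoword of an ordinary word. -/
noncomputable def ofWord : FreeMonoid A →* Pseudoword A :=
  FreeMonoid.lift of

theorem ofWord_of (a : A) : ofWord (FreeMonoid.of a) = of a :=
  FreeMonoid.lift_eval_of ..

theorem proj_ofWord (c : FinCon A) (x : FreeMonoid A) : proj c (ofWord x) = Con.mk' c.1 x := by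
  have h : (proj c).comp ofWord = Con.mk' c.1 := by
    apply FreeMonoid.hom_eq
    intro a
    rw [MonoidHom.comp_apply, ofWord_of]
    rfl
  exact DFunLike.congr_fun h x

theorem exists_word (c : FinCon A) (u : Pseudoword A) :
    ∃ x : FreeMonoid A, proj c u = proj c (ofWord x) := by
  obtain ⟨x, hx⟩ := Con.mk'_surjective (proj c u)
  exact ⟨x, by rw [proj_ofWord, hx]⟩

/-- The kernel of the map into the product of the two quotients works. Finite-index congruences are
thus directed, and finitely many conditions on projections reduce to one. -/
theorem exists_le_le (c d : FinCon A) : ∃ e : FinCon A, e.1 ≤ c.1 ∧ e.1 ≤ d.1 := by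
  let f : FreeMonoid A →* c.1.Quotient × d.1.Quotient := (Con.mk' c.1).prod (Con.mk' d.1)
  refine ⟨⟨Con.ker f, Finite.of_injective _ (Con.kerLift_injective f)⟩, ?_, ?_⟩
  · intro x y h
    exact (Con.eq _).1 (congrArg Prod.fst h)
  · intro x y h
    exact (Con.eq _).1 (congrArg Prod.snd h)

theorem exists_le_forall (I : Finset (FinCon A)) : ∃ e : FinCon A, ∀ c ∈ I, e.1 ≤ c.1 := by
  classical
  induction I using Finset.induction_on with
  | empty =>
    have : Subsingleton (⊤ : Con (FreeMonoid A)).Quotient := ⟨fun a b => by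
      obtain ⟨a, rfl⟩ := Con.mk'_surjective a
      obtain ⟨b, rfl⟩ := Con.mk'_surjective b
      exact (Con.eq _).2 trivial⟩
    exact ⟨⟨⊤, Finite.of_subsingleton⟩, by simp⟩
  | insert c I _ ih =>
    obtain ⟨e, he⟩ := ih
    obtain ⟨e', h1, h2⟩ := exists_le_le c e
    refine ⟨e', fun d hd => ?_⟩
    rcases Finset.mem_insert.1 hd with rfl | hd
    · exact h1
    · exact h2.trans (he d hd)

/-- The discrete topology on the finite quotients of a free monoid. -/
local instance discreteQuotient (c : FinCon A) : TopologicalSpace c.1.Quotient := ⊥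

local instance discreteTopologyQuotient (c : FinCon A) : DiscreteTopology c.1.Quotient := ⟨rfl⟩

theorem isEmbedding_val :
    IsEmbedding (fun u : Pseudoword A => (u.1 : ∀ c : FinCon A, c.1.Quotient)) :=
  ⟨⟨rfl⟩, Subtype.val_injective⟩

theorem continuous_proj (c : FinCon A) : Continuous (proj c : Pseudoword A → c.1.Quotient) :=
  (continuous_apply c).comp isEmbedding_val.continuous

theorem isClopen_proj (c : FinCon A) (q : c.1.Quotient) :
    IsClopen {u : Pseudoword A | proj c u = q} :=
  (isClopen_discrete ({q} : Set c.1.Quotient)).preimage (continuous_proj c)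

instance : T2Space (Pseudoword A) := isEmbedding_val.t2Space

instance : CompactSpace (Pseudoword A) := by
  apply IsClosedEmbedding.compactSpace (f := fun u : Pseudoword A =>
    (u.1 : ∀ c : FinCon A, c.1.Quotient))
  refine ⟨isEmbedding_val, ?_⟩
  have e : Set.range (fun u : Pseudoword A => (u.1 : ∀ c : FinCon A, c.1.Quotient)) =
      ⋂ (c : FinCon A) (d : FinCon A) (h : c.1 ≤ d.1),
        {f | Con.map c.1 d.1 h (f c) = f d} := by
    ext f
    simp only [Set.mem_range, Set.mem_iInter, Set.mem_ofPred_eq]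
    exact ⟨fun ⟨u, hu⟩ c d h => hu ▸ u.2 c d h, fun h => ⟨⟨f, h⟩, rfl⟩⟩
  rw [e]
  refine isClosed_iInter fun c => isClosed_iInter fun d => isClosed_iInter fun h => ?_
  exact isClosed_eq (continuous_of_discreteTopology.comp (continuous_apply c))
    (continuous_apply d)

/-- The fibres of the projections to finite quotients form a basis of the topology. -/
theorem exists_proj_subset {U : Set (Pseudoword A)} (hU : IsOpen U) {u : Pseudoword A}
    (hu : u ∈ U) : ∃ c : FinCon A, ∀ v, proj c v = proj c u → v ∈ U := by
  obtain ⟨V, hV, rfl⟩ := isEmbedding_val.isOpen_iff.1 hU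
  obtain ⟨I, t, ht, hsub⟩ := isOpen_pi_iff.1 hV _ hu
  obtain ⟨e, he⟩ := exists_le_forall I
  refine ⟨e, fun v hv => hsub fun c hc => ?_⟩
  have h1 : v.1 c = u.1 c := proj_eq_of_le (he c hc) hv
  show v.1 c ∈ t c
  rw [h1]
  exact (ht c hc).2

theorem isOpen_of_forall_proj {U : Set (Pseudoword A)}
    (h : ∀ u ∈ U, ∃ c : FinCon A, ∀ v, proj c v = proj c u → v ∈ U) : IsOpen U := by
  rw [isOpen_iff_mem_nhds]
  intro u hu
  obtain ⟨c, hc⟩ := h u hu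
  exact Filter.mem_of_superset ((isClopen_proj c (proj c u)).isOpen.mem_nhds rfl) hc

theorem mem_closure_iff_proj {s : Set (Pseudoword A)} {u : Pseudoword A} :
    u ∈ closure s ↔ ∀ c : FinCon A, ∃ v ∈ s, proj c v = proj c u := by
  rw [mem_closure_iff]
  constructor
  · intro h c
    obtain ⟨v, hv, hs⟩ := h _ (isClopen_proj c (proj c u)).isOpen rfl
    exact ⟨v, hs, hv⟩
  · intro h U hU hu
    obtain ⟨c, hc⟩ := exists_proj_subset hU hu
    obtain ⟨v, hs, hv⟩ := h c
    exact ⟨v, hc v hv, hs⟩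

/-- This is how limits are taken below: in each finite quotient, `u^ω` is replaced by a finite power
of `u` with the same projection. -/
theorem mem_of_isClosed_of_proj {R : Set (Pseudoword A × Pseudoword A)} (hR : IsClosed R)
    {u v : Pseudoword A}
    (h : ∀ c : FinCon A, ∃ p ∈ R, proj c p.1 = proj c u ∧ proj c p.2 = proj c v) :
    (u, v) ∈ R := by
  rw [← hR.closure_eq, mem_closure_iff_nhds]
  intro W hW
  rw [nhds_prod_eq, Filter.mem_prod_iff] at hW
  obtain ⟨U, hU, V, hV, hUV⟩ := hW
  obtain ⟨U', hU', hUo, hu⟩ := mem_nhds_iff.1 hU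
  obtain ⟨V', hV', hVo, hv⟩ := mem_nhds_iff.1 hV
  obtain ⟨c, hc⟩ := exists_proj_subset hUo hu
  obtain ⟨d, hd⟩ := exists_proj_subset hVo hv
  obtain ⟨e, h1, h2⟩ := exists_le_le c d
  obtain ⟨p, hp, hpu, hpv⟩ := h e
  exact ⟨p, hUV ⟨hU' (hc _ (proj_eq_of_le h1 hpu)), hV' (hd _ (proj_eq_of_le h2 hpv))⟩, hp⟩

instance : ContinuousMul (Pseudoword A) := by
  refine ⟨isEmbedding_val.continuous_iff.2 (continuous_pi fun c => ?_)⟩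
  have h1 : Continuous fun p : Pseudoword A × Pseudoword A => (proj c p.1, proj c p.2) :=
    ((continuous_proj c).comp continuous_fst).prodMk ((continuous_proj c).comp continuous_snd)
  exact (continuous_of_discreteTopology
    (f := fun p : c.1.Quotient × c.1.Quotient => p.1 * p.2)).comp h1

/-! ## Evaluation and continuous homomorphisms -/

theorem eval_proj {T : Type} [Monoid T] [Finite T] (φ : A → T) {u v : Pseudoword A}
    (h : proj (kerFin φ) u = proj (kerFin φ) v) : eval φ u = eval φ v :=
  congrArg (Con.kerLift (FreeMonoid.lift φ)) h

theorem eval_ofWord {T : Type} [Monoid T] [Finite T] (φ : A → T) (x : FreeMonoid A) :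
    eval φ (ofWord x) = FreeMonoid.lift φ x := by
  have h : (eval φ).comp ofWord = FreeMonoid.lift φ := by
    apply FreeMonoid.hom_eq
    intro a
    rw [MonoidHom.comp_apply, ofWord_of, eval_of, FreeMonoid.lift_eval_of]
  exact DFunLike.congr_fun h x

theorem eval_omega {T : Type} [Monoid T] [Finite T] (φ : A → T) (u : Pseudoword A) :
    eval φ u.omega = omegaPow (eval φ u) :=
  map_omegaPow (S := (kerFin φ).1.Quotient) (Con.kerLift (FreeMonoid.lift φ)) (proj (kerFin φ) u)

/-- A homomorphism to a finite monoid that factors through a projection is an evaluation. -/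
theorem eval_eq_of_proj {T : Type} [Monoid T] [Finite T] (f : Pseudoword A →* T)
    (c : FinCon A) (hf : ∀ u v, proj c u = proj c v → f u = f v) (u : Pseudoword A) :
    eval (fun a => f (of a)) u = f u := by
  -- In a quotient fine enough for both maps, `u` may be replaced by a word, where agreement on
  -- letters suffices.
  obtain ⟨e, h1, h2⟩ := exists_le_le c (kerFin fun a => f (of a))
  obtain ⟨x, hx⟩ := exists_word e u
  rw [eval_proj _ (proj_eq_of_le h2 hx), hf _ _ (proj_eq_of_le h1 hx), eval_ofWord]
  have h : FreeMonoid.lift (fun a => f (of a)) = f.comp ofWord := by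
    apply FreeMonoid.hom_eq
    intro a
    rw [MonoidHom.comp_apply, ofWord_of, FreeMonoid.lift_eval_of]
  rw [h]
  rfl

theorem map_eval {S T : Type} [Monoid S] [Finite S] [Monoid T] [Finite T] (f : S →* T)
    (φ : A → S) (u : Pseudoword A) : f (eval φ u) = eval (fun a => f (φ a)) u := by
  have h := eval_eq_of_proj (f.comp (eval φ)) (kerFin φ)
    (fun u v h => congrArg f (eval_proj φ h)) u
  simp only [MonoidHom.comp_apply, eval_of] at h
  exact h.symm

/-- The continuous homomorphism that extends a map from the alphabet to the pseudowords. -/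
noncomputable def extend {B : Type} (f : B → Pseudoword A) : Pseudoword B →* Pseudoword A where
  toFun u := ⟨fun c => eval (fun b => proj c (f b)) u, fun c d h => by
    rw [map_eval]
    simp only [map_proj h]⟩
  map_one' := ext_proj fun c => map_one (eval fun b => proj c (f b))
  map_mul' u v := ext_proj fun c => map_mul (eval fun b => proj c (f b)) u v

theorem proj_extend {B : Type} (f : B → Pseudoword A) (c : FinCon A) (u : Pseudoword B) :
    proj c (extend f u) = eval (fun b => proj c (f b)) u :=
  rfl

theorem extend_of {B : Type} (f : B → Pseudoword A) (b : B) : extend f (of b) = f b :=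
  ext_proj fun c => by rw [proj_extend, eval_of]

theorem extend_omega {B : Type} (f : B → Pseudoword A) (u : Pseudoword B) :
    extend f u.omega = (extend f u).omega :=
  ext_proj fun c => by rw [proj_extend, eval_omega, proj_omega, proj_extend]

theorem continuous_extend {B : Type} (f : B → Pseudoword A) : Continuous (extend f) := by
  rw [continuous_def]
  intro U hU
  refine isOpen_of_forall_proj fun u hu => ?_
  obtain ⟨c, hc⟩ := exists_proj_subset hU hu
  exact ⟨kerFin fun b => proj c (f b), fun v hv => hc _ (eval_proj _ hv)⟩

theorem omega_mul_swap (u v : Pseudoword A) : (u * v).omega * u = u * (v * u).omega :=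
  ext_proj fun c => by
    simp only [map_mul, proj_omega]
    exact omegaPow_mul_swap _ _

theorem omega_mul_omega (u : Pseudoword A) : u.omega * u.omega = u.omega :=
  ext_proj fun c => by
    rw [map_mul, proj_omega]
    exact isIdempotentElem_omegaPow _

end Pseudoword

/-! ## Closed congruences -/

namespace Pseudoword

variable {A : Type}

theorem mul_omega_comm (u : Pseudoword A) : u.omega * u = u * u.omega := by
  simpa using omega_mul_swap u 1

/-- A closed congruence that identifies `z^{ω+1}` with `z^ω` and `(xy)^ω` with `(yx)^ω` also
identifies `(xy)^ω x` with `(xy)^ω`. -/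
theorem rel_omega_mul_left {R : Con (Pseudoword A)}
    (hR : IsClosed {p : Pseudoword A × Pseudoword A | R p.1 p.2})
    (h1 : ∀ z : Pseudoword A, R (z.omega * z) z.omega)
    (h2 : ∀ x y : Pseudoword A, R (x * y).omega (y * x).omega) (x y : Pseudoword A) :
    R ((x * y).omega * x) (x * y).omega := by
  -- Modulo `R`, `E` commutes with `x` and `y`, so `Ex` and `Ey` are mutually inverse with respect
  -- to the identity `E`. Since `z^{ω+1} = z^ω`, this group is trivial: `g = gE = g g^ω k^ω = g^ω
  -- k^ω = E`.
  set q := Con.mk' R with hq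
  have hqe : ∀ {a b : Pseudoword A}, q a = q b ↔ R a b := fun {a b} => Con.eq R
  set E := q (x * y).omega with hE
  have hE' : E = q (y * x).omega := hqe.2 (h2 x y)
  have hEE : E * E = E := by rw [hE, ← map_mul, omega_mul_omega]
  have hEX : E * q x = q x * E := by
    conv_rhs => rw [hE']
    rw [hE, ← map_mul, ← map_mul, omega_mul_swap]
  have hEY : E * q y = q y * E := by
    conv_lhs => rw [hE']
    rw [hE, ← map_mul, ← map_mul, omega_mul_swap]
  have hXY : E * q x * q y = E := by
    rw [hE, mul_assoc, ← map_mul, ← map_mul]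
    exact hqe.2 (h1 _)
  have hYX : E * q y * q x = E := by
    rw [hE', mul_assoc, ← map_mul, ← map_mul]
    exact hqe.2 (h1 _)
  have hP : (E * q x) * (E * q y) = E := by
    calc (E * q x) * (E * q y) = E * (q x * E) * q y := by simp only [mul_assoc]
      _ = (E * E) * q x * q y := by rw [← hEX]; simp only [mul_assoc]
      _ = E := by rw [hEE, hXY]
  have hP' : (E * q y) * (E * q x) = E := by
    calc (E * q y) * (E * q x) = E * (q y * E) * q x := by simp only [mul_assoc]
      _ = (E * E) * q y * q x := by rw [← hEY]; simp only [mul_assoc]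
      _ = E := by rw [hEE, hYX]
  -- For `n = 0` the product would be `1` rather than `E`.
  have hpow : ∀ n : ℕ, 0 < n → (E * q x) ^ n * (E * q y) ^ n = E := by
    intro n hn
    have hc : Commute (E * q x) (E * q y) := hP.trans hP'.symm
    rw [← hc.mul_pow, hP]
    exact IsIdempotentElem.pow_eq hEE hn.ne'
  set g := (x * y).omega * x with hg
  set k := (x * y).omega * y with hk
  have hqg : q g = E * q x := by rw [hg, map_mul]
  have hqk : q k = E * q y := by rw [hk, map_mul]
  have hlim : R (g.omega * k.omega) (x * y).omega := by
    refine mem_of_isClosed_of_proj (u := g.omega * k.omega) (v := (x * y).omega) hR fun c => ?_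
    obtain ⟨n, hn, e1, e2⟩ := exists_omegaPow_eq_pow (proj c g) (proj c k)
    refine ⟨(g ^ n * k ^ n, (x * y).omega), ?_, ?_, rfl⟩
    · refine hqe.1 ?_
      rw [map_mul, map_pow, map_pow, hqg, hqk, hpow n hn]
    · simp only [map_mul, map_pow, proj_omega, e1, e2]
  have hgE : q g * E = q g := by
    rw [hqg, mul_assoc, ← hEX, ← mul_assoc, hEE]
  refine hqe.1 ?_
  calc q g = q g * E := hgE.symm
    _ = q g * q (g.omega * k.omega) := by rw [hqe.2 hlim]
    _ = q (g * g.omega) * q k.omega := by simp only [map_mul, mul_assoc]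
    _ = q (g.omega * g) * q k.omega := by rw [mul_omega_comm]
    _ = q (g.omega * k.omega) := by rw [hqe.2 (h1 g), map_mul]
    _ = E := hqe.2 hlim

/-- Dual of the left law by exchanging `x` and `y`, since `y (xy)^ω = (yx)^ω y`. -/
theorem rel_omega_mul_right {R : Con (Pseudoword A)}
    (hR : IsClosed {p : Pseudoword A × Pseudoword A | R p.1 p.2})
    (h1 : ∀ z : Pseudoword A, R (z.omega * z) z.omega)
    (h2 : ∀ x y : Pseudoword A, R (x * y).omega (y * x).omega) (x y : Pseudoword A) :
    R (x * y).omega (y * (x * y).omega) := by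
  rw [← omega_mul_swap y x]
  exact R.trans (h2 x y) (R.symm (rel_omega_mul_left hR h1 h2 y x))

theorem isClosed_ker_eval {T : Type} [Monoid T] [Finite T] (φ : A → T) :
    IsClosed {p : Pseudoword A × Pseudoword A | Con.ker (eval φ) p.1 p.2} := by
  let _ : TopologicalSpace T := ⊥
  have : DiscreteTopology T := ⟨rfl⟩
  have hc : Continuous (eval φ) := by
    rw [continuous_def]
    intro U _
    exact isOpen_of_forall_proj fun u hu => ⟨kerFin φ, fun v hv => by
      rw [Set.mem_preimage, eval_proj φ hv]
      exact hu⟩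
  exact isClosed_eq (hc.comp continuous_fst) (hc.comp continuous_snd)

end Pseudoword

open Pseudoword

/-! ## The finite monoids that satisfy the pseudoidentities -/

theorem models_sigmaJ_iff (T : Type) [Monoid T] [Finite T] :
    Models T sigmaJ ↔ (∀ z : T, omegaPow z * z = omegaPow z) ∧
      ∀ x y : T, omegaPow (x * y) = omegaPow (y * x) := by
  constructor
  · intro h
    refine ⟨fun z => ?_, fun x y => ?_⟩
    · have h1 := h _ (Or.inl rfl) fun _ => z
      simpa only [map_mul, eval_omega, eval_of] using h1
    · have h1 := h _ (Or.inr rfl) ![x, y]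
      simpa [letterX, letterY, eval_omega, eval_of] using h1
  · rintro ⟨h1, h2⟩ p (rfl | rfl) φ
    · simpa only [map_mul, eval_omega, eval_of] using h1 _
    · simpa only [letterX, letterY, map_mul, eval_omega, eval_of] using h2 _ _

theorem models_gammaJ_iff (T : Type) [Monoid T] [Finite T] :
    Models T gammaJ ↔ ∀ x y : T, omegaPow (x * y) * x = omegaPow (x * y) ∧
      omegaPow (x * y) = y * omegaPow (x * y) := by
  constructor
  · intro h x y
    have h1 := h _ (Or.inl rfl) ![x, y]
    have h2 := h _ (Or.inr rfl) ![x, y]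
    simp only [letterX, letterY, map_mul, eval_omega, eval_of] at h1 h2
    exact ⟨h1, h2⟩
  · rintro h p (rfl | rfl) φ
    · simpa only [letterX, letterY, map_mul, eval_omega, eval_of] using (h _ _).1
    · simpa only [letterX, letterY, map_mul, eval_omega, eval_of] using (h _ _).2

theorem models_gammaJ_iff_isJTrivial (T : Type) [Monoid T] [Finite T] :
    Models T gammaJ ↔ IsJTrivial T := by
  rw [models_gammaJ_iff]
  exact ⟨isJTrivial_of_omegaPow_absorb, omegaPow_absorb_of_isJTrivial⟩

theorem models_sigmaJ_iff_isJTrivial (T : Type) [Monoid T] [Finite T] :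
    Models T sigmaJ ↔ IsJTrivial T := by
  rw [← models_gammaJ_iff_isJTrivial, models_gammaJ_iff, models_sigmaJ_iff]
  constructor
  · rintro ⟨h1, h2⟩ x y
    -- The kernel of evaluation at `(x, y)` is a closed congruence, so the abstract derivation
    -- yields the laws inside `T`.
    have hR := isClosed_ker_eval ![x, y]
    have h1' : ∀ z, Con.ker (eval ![x, y]) (z.omega * z) z.omega := fun z => by
      rw [Con.ker_rel, map_mul, eval_omega, h1]
    have h2' : ∀ z w : Pseudoword (Fin 2), Con.ker (eval ![x, y]) (z * w).omega (w * z).omega := fun z w => by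
      rw [Con.ker_rel, eval_omega, eval_omega, map_mul, map_mul, h2]
    have hl := rel_omega_mul_left hR h1' h2' (of 0) (of 1)
    have hr := rel_omega_mul_right hR h1' h2' (of 0) (of 1)
    simp only [Con.ker_rel, map_mul, eval_omega, eval_of] at hl hr
    exact ⟨hl, hr⟩
  · intro h
    -- Setting `y = 1` gives the first law; the second is `(xy)^ω = (xy)^ω x = x (yx)^ω = (yx)^ω`.
    refine ⟨fun z => by simpa using (h z 1).1, fun x y => ?_⟩
    rw [← (h x y).1, omegaPow_mul_swap, ← (h y x).2]

/-! ## The stages of the proof scheme -/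

/-- Inductions over stages can then treat every successor without tracking parity. -/
theorem stage_add_one (S : Set Pseudoidentity) (A : Type) (α : Ordinal.{0}) :
    stage S A (α + 1) = transClosure (stage S A α) ∨
      stage S A (α + 1) = closure (stage S A α) := by
  unfold stage
  rw [Ordinal.limitRecOn_add_one]
  split_ifs
  · exact Or.inl rfl
  · exact Or.inr rfl

theorem subset_transClosure {X : Type} (R : Set (X × X)) : R ⊆ transClosure R :=
  fun _ h => Relation.TransGen.single h

theorem stage_subset_add_one (S : Set Pseudoidentity) (A : Type) (α : Ordinal.{0}) :
    stage S A α ⊆ stage S A (α + 1) := by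
  rcases stage_add_one S A α with h | h
  · rw [h]; exact subset_transClosure _
  · rw [h]; exact subset_closure

theorem stage_mono (S : Set Pseudoidentity) (A : Type) {α β : Ordinal.{0}} (h : α ≤ β) :
    stage S A α ⊆ stage S A β := by
  induction β using Ordinal.limitRecOn with
  | zero => rw [le_antisymm h zero_le]
  | add_one β ih =>
    rcases h.eq_or_lt with rfl | h
    · exact le_rfl
    · exact (ih (Order.lt_add_one_iff.1 h)).trans (stage_subset_add_one S A β)
  | limit β hβ _ =>
    rcases h.eq_or_lt with rfl | h
    · exact le_rfl
    · rw [stage_limit S A β hβ]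
      exact Set.subset_iUnion₂ (s := fun γ (_ : γ < β) => stage S A γ) α h

/-- A continuous transformation of pairs that preserves the base step and is compatible with
transitive closure preserves provability. -/
theorem stage_maps_to {S : Set Pseudoidentity} {A : Type}
    {F : Pseudoword A × Pseudoword A → Pseudoword A × Pseudoword A} (hF : Continuous F)
    (hbase : Set.MapsTo F (baseStep S A) (baseStep S A))
    (htrans : ∀ R, Set.MapsTo F R R → Set.MapsTo F (transClosure R) (transClosure R))
    (α : Ordinal.{0}) : Set.MapsTo F (stage S A α) (stage S A α) := by
  induction α using Ordinal.limitRecOn with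
  | zero => rwa [stage_zero]
  | add_one α ih =>
    rcases stage_add_one S A α with h | h
    · rw [h]; exact htrans _ ih
    · rw [h]; exact ih.closure hF
  | limit α hα ih =>
    rw [stage_limit S A α hα]
    intro p hp
    simp only [Set.mem_iUnion] at hp ⊢
    obtain ⟨γ, hγ, hp⟩ := hp
    exact ⟨γ, hγ, ih γ hγ hp⟩

/-- Renaming of the variables of a term. -/
def MonoidTerm.rename {X Y : Type} (g : X → Y) : MonoidTerm X → MonoidTerm Y
  | var x => var (g x)
  | one => one
  | mul s t => mul (s.rename g) (t.rename g)

theorem MonoidTerm.eval_rename {X Y M : Type} [Monoid M] (g : X → Y) (f : Y → M)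
    (t : MonoidTerm X) : (t.rename g).eval f = t.eval (f ∘ g) := by
  induction t with
  | var x => rfl
  | one => rfl
  | mul s t hs ht =>
    show (s.rename g).eval f * (t.rename g).eval f = _
    rw [hs, ht]
    rfl

/-- Appending a parameter `a` as a new last variable leaves the old term unchanged, so `t` can be
multiplied by `a` within the term formalism. -/
theorem eval_rename_cons_snoc {M : Type} [Monoid M] {n : ℕ} (t : MonoidTerm (Fin (n + 1)))
    (x a : M) (w : Fin n → M) :
    (t.rename Fin.castSucc).eval (Fin.cons x (Fin.snoc w a : Fin (n + 1) → M)) =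
      t.eval (Fin.cons x w : Fin (n + 1) → M) := by
  rw [MonoidTerm.eval_rename, Fin.cons_snoc_eq_snoc_cons]
  congr 1
  funext i
  exact Fin.snoc_castSucc (α := fun _ => M) a (Fin.cons x w) i

theorem cons_snoc_last {M : Type} {n : ℕ} (x a : M) (w : Fin n → M) :
    (Fin.cons x (Fin.snoc w a : Fin (n + 1) → M) : Fin (n + 2) → M) (Fin.last (n + 1)) = a := by
  rw [Fin.cons_snoc_eq_snoc_cons]
  exact Fin.snoc_last (α := fun _ => M) a (Fin.cons x w)

theorem baseStep_mul_left {S : Set Pseudoidentity} {A : Type} (a : Pseudoword A) :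
    Set.MapsTo (fun p : Pseudoword A × Pseudoword A => (a * p.1, a * p.2))
      (baseStep S A) (baseStep S A) := by
  rintro _ ⟨p, hp, u, v, huv, φ, hφ, n, t, w, rfl⟩
  refine ⟨p, hp, u, v, huv, φ, hφ, n + 1,
    .mul (.var (Fin.last (n + 1))) (t.rename Fin.castSucc), Fin.snoc w a, ?_⟩
  simp only [MonoidTerm.eval, eval_rename_cons_snoc, cons_snoc_last]

theorem baseStep_mul_right {S : Set Pseudoidentity} {A : Type} (a : Pseudoword A) :
    Set.MapsTo (fun p : Pseudoword A × Pseudoword A => (p.1 * a, p.2 * a))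
      (baseStep S A) (baseStep S A) := by
  rintro _ ⟨p, hp, u, v, huv, φ, hφ, n, t, w, rfl⟩
  refine ⟨p, hp, u, v, huv, φ, hφ, n + 1,
    .mul (t.rename Fin.castSucc) (.var (Fin.last (n + 1))), Fin.snoc w a, ?_⟩
  simp only [MonoidTerm.eval, eval_rename_cons_snoc, cons_snoc_last]

theorem baseStep_swap {S : Set Pseudoidentity} {A : Type} :
    Set.MapsTo Prod.swap (baseStep S A) (baseStep S A) := by
  rintro _ ⟨p, hp, u, v, huv, φ, hφ, n, t, w, rfl⟩
  exact ⟨p, hp, v, u, huv.symm.imp And.symm And.symm, φ, hφ, n, t, w, rfl⟩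

theorem provable_of_baseStep {S : Set Pseudoidentity} {A : Type} {u v : Pseudoword A}
    (h : (u, v) ∈ baseStep S A) : Provable S u v :=
  ⟨0, by rwa [stage_zero]⟩

theorem provable_refl {S : Set Pseudoidentity} (hS : S.Nonempty) {A : Type}
    (u : Pseudoword A) : Provable S u u := by
  obtain ⟨p, hp⟩ := hS
  -- The term is the parameter variable `1`, not the hole `0`, so both sides are `u`; some member of
  -- `S` must still be cited.
  exact provable_of_baseStep ⟨p, hp, p.lhs, p.rhs, Or.inl ⟨rfl, rfl⟩, extend fun _ => 1,
    continuous_extend _, 1, .var 1, fun _ => u, rfl⟩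

theorem provable_symm {S : Set Pseudoidentity} {A : Type} {u v : Pseudoword A}
    (h : Provable S u v) : Provable S v u := by
  obtain ⟨α, hα⟩ := h
  refine ⟨α, stage_maps_to (F := Prod.swap) continuous_swap baseStep_swap ?_ α hα⟩
  intro R hR p hp
  exact Relation.TransGen.mono (fun x y h => @hR (y, x) h) p.2 p.1
    (Relation.TransGen.swap p.2 p.1 hp)

theorem provable_mul_left {S : Set Pseudoidentity} {A : Type} {u v : Pseudoword A}
    (a : Pseudoword A) (h : Provable S u v) : Provable S (a * u) (a * v) := by
  obtain ⟨α, hα⟩ := h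
  refine ⟨α, stage_maps_to (F := fun p => (a * p.1, a * p.2)) (by fun_prop)
    (baseStep_mul_left a) ?_ α hα⟩
  intro R hR p hp
  exact Relation.TransGen.lift (fun x => a * x) (fun x y h => @hR (x, y) h) p.1 p.2 hp

theorem provable_mul_right {S : Set Pseudoidentity} {A : Type} {u v : Pseudoword A}
    (a : Pseudoword A) (h : Provable S u v) : Provable S (u * a) (v * a) := by
  obtain ⟨α, hα⟩ := h
  refine ⟨α, stage_maps_to (F := fun p => (p.1 * a, p.2 * a)) (by fun_prop)
    (baseStep_mul_right a) ?_ α hα⟩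
  intro R hR p hp
  exact Relation.TransGen.lift (fun x => x * a) (fun x y h => @hR (x, y) h) p.1 p.2 hp

theorem provable_trans {S : Set Pseudoidentity} {A : Type} {u v w : Pseudoword A}
    (h : Provable S u v) (h' : Provable S v w) : Provable S u w := by
  obtain ⟨α, hα⟩ := h
  obtain ⟨β, hβ⟩ := h'
  -- Doubling reaches an even stage, whose successor is a transitive closure.
  have hle : max α β ≤ 2 * max α β := Ordinal.le_mul_right _ (by simp)
  refine ⟨2 * max α β + 1, ?_⟩
  rw [stage_odd]
  exact .tail (.single (stage_mono S A ((le_max_left α β).trans hle) hα))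
    (stage_mono S A ((le_max_right α β).trans hle) hβ)

/-- The congruence of provability from a nonempty set of pseudoidentities. -/
noncomputable def provableCon (S : Set Pseudoidentity) (hS : S.Nonempty) (A : Type) :
    Con (Pseudoword A) where
  r u v := Provable S u v
  iseqv := ⟨provable_refl hS, provable_symm, provable_trans⟩
  mul' h h' := provable_trans (provable_mul_right _ h) (provable_mul_left _ h')

/-- Provable pairs form a small set, so the stages at which they appear have a supremum; one odd
stage contains them all, and the next is its closure. -/
theorem isClosed_provable (S : Set Pseudoidentity) (A : Type) :
    IsClosed {p : Pseudoword A × Pseudoword A | Provable S p.1 p.2} := by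
  choose f hf using fun p : {p : Pseudoword A × Pseudoword A // Provable S p.1 p.2} => p.2
  let σ : Ordinal.{0} := ⨆ p, f p
  have hσ : σ ≤ 2 * σ + 1 := (Ordinal.le_mul_right _ (by simp)).trans le_self_add
  have hsub : {p : Pseudoword A × Pseudoword A | Provable S p.1 p.2} ⊆ stage S A (2 * σ + 1) :=
    fun p hp => stage_mono S A ((Ordinal.le_iSup f ⟨p, hp⟩).trans hσ) (hf ⟨p, hp⟩)
  refine isClosed_of_closure_subset fun p hp => ⟨2 * σ + 2, ?_⟩
  rw [stage_even]
  exact closure_mono hsub hp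

theorem provable_extend {S : Set Pseudoidentity} {A : Type} {p : Pseudoidentity} (hp : p ∈ S)
    (f : p.alphabet → Pseudoword A) : Provable S (extend f p.lhs) (extend f p.rhs) :=
  provable_of_baseStep ⟨p, hp, p.lhs, p.rhs, Or.inl ⟨rfl, rfl⟩, extend f, continuous_extend f,
    0, .var 0, Fin.elim0, rfl⟩

namespace Pseudoword

variable {A : Type}

theorem exists_eq_mul_of_mem {a : A} {u : FreeMonoid A} (h : a ∈ u) :
    ∃ x y : FreeMonoid A, u = x * FreeMonoid.of a * y := by
  obtain ⟨s, t, hst⟩ := List.append_of_mem (show a ∈ u.toList from h)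
  refine ⟨FreeMonoid.ofList s, FreeMonoid.ofList t, FreeMonoid.toList.injective ?_⟩
  simp [hst]

/-! ## Congruences that identify `(xy)^ω x`, `(xy)^ω` and `y (xy)^ω` -/

section Absorption

variable {R : Con (Pseudoword A)}
  (hR : IsClosed {p : Pseudoword A × Pseudoword A | R p.1 p.2})
  (hl : ∀ x y : Pseudoword A, R ((x * y).omega * x) (x * y).omega)
  (hr : ∀ x y : Pseudoword A, R (x * y).omega (y * (x * y).omega))

include hl hr in
-- Write `u = xay` and `e = u^ω`. Bracketing `u` as `x·ay` and as `xa·y` shows that `e` absorbs both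
-- `x` and `xa` on the right, so `ea ~ exa ~ e`. On the left it absorbs `y` and `ay`.
theorem rel_omega_absorb_letter {u : FreeMonoid A} {a : A} (h : a ∈ u) :
    R ((ofWord u).omega * of a) (ofWord u).omega ∧
      R (of a * (ofWord u).omega) (ofWord u).omega := by
  obtain ⟨x, y, rfl⟩ := exists_eq_mul_of_mem h
  simp only [map_mul, ofWord_of]
  generalize ofWord x = x
  generalize ofWord y = y
  generalize of a = z
  have h1 := hl x (z * y)
  have h2 := hl (x * z) y
  have h3 := hr x (z * y)
  have h4 := hr (x * z) y
  simp only [← mul_assoc] at h1 h2 h3 h4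
  refine ⟨R.trans (R.symm (R.mul h1 (R.refl z))) h2, ?_⟩
  have h5 := R.mul (R.refl z) h4
  rw [← mul_assoc] at h5
  exact R.trans h5 (R.symm h3)

include hl hr in
theorem rel_omega_absorb_word {u : FreeMonoid A} (x : FreeMonoid A) (h : ∀ a ∈ x, a ∈ u) :
    R ((ofWord u).omega * ofWord x) (ofWord u).omega ∧
      R (ofWord x * (ofWord u).omega) (ofWord u).omega := by
  induction x using FreeMonoid.inductionOn with
  | one => simp only [map_one, mul_one, one_mul]; exact ⟨R.refl _, R.refl _⟩
  | of a =>
    rw [ofWord_of]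
    exact rel_omega_absorb_letter hl hr (h a FreeMonoid.mem_of_self)
  | mul x y hx hy =>
    obtain ⟨hx1, hx2⟩ := hx fun a ha => h a (FreeMonoid.mem_mul.2 (Or.inl ha))
    obtain ⟨hy1, hy2⟩ := hy fun a ha => h a (FreeMonoid.mem_mul.2 (Or.inr ha))
    rw [MonoidHom.map_mul ofWord]
    constructor
    · rw [← mul_assoc]
      exact R.trans (R.mul hx1 (R.refl _)) hy1
    · rw [mul_assoc]
      exact R.trans (R.mul (R.refl _) hy2) hx2

include hR hl hr in
-- The product `u^ω v^ω` is equivalent to both factors, each absorbing the powers that approximate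
-- the other.
theorem rel_omega_omega {u v : FreeMonoid A} (h : ∀ a, a ∈ u ↔ a ∈ v) :
    R (ofWord u).omega (ofWord v).omega := by
  have key : R ((ofWord u).omega * (ofWord v).omega) (ofWord u).omega := by
    refine mem_of_isClosed_of_proj (u := (ofWord u).omega * (ofWord v).omega)
      (v := (ofWord u).omega) hR fun c => ?_
    obtain ⟨n, -, hn, -⟩ := exists_omegaPow_eq_pow (proj c (ofWord v)) (proj c (ofWord v))
    refine ⟨((ofWord u).omega * ofWord v ^ n, (ofWord u).omega), ?_, ?_, rfl⟩
    · show R ((ofWord u).omega * ofWord v ^ n) (ofWord u).omega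
      clear hn
      induction n with
      | zero => rw [pow_zero, mul_one]; exact R.refl _
      | succ n ih =>
        rw [pow_succ, ← mul_assoc]
        exact R.trans (R.mul ih (R.refl _))
          (rel_omega_absorb_word hl hr v fun a ha => (h a).2 ha).1
    · simp only [map_mul, map_pow, proj_omega, hn]
  have key' : R ((ofWord u).omega * (ofWord v).omega) (ofWord v).omega := by
    refine mem_of_isClosed_of_proj (u := (ofWord u).omega * (ofWord v).omega)
      (v := (ofWord v).omega) hR fun c => ?_
    obtain ⟨n, -, hn, -⟩ := exists_omegaPow_eq_pow (proj c (ofWord u)) (proj c (ofWord u))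
    refine ⟨(ofWord u ^ n * (ofWord v).omega, (ofWord v).omega), ?_, ?_, rfl⟩
    · show R (ofWord u ^ n * (ofWord v).omega) (ofWord v).omega
      clear hn
      induction n with
      | zero => rw [pow_zero, one_mul]; exact R.refl _
      | succ n ih =>
        rw [pow_succ', mul_assoc]
        exact R.trans (R.mul (R.refl _) ih)
          (rel_omega_absorb_word hl hr u fun a ha => (h a).1 ha).2
    · simp only [map_mul, map_pow, proj_omega, hn]
  exact R.trans (R.symm key) key'

end Absorption

/-! ## Factorizations of words into blocks of full content -/

/-- The words all of whose letters belong to `B`. -/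
def wordsOver (B : Finset A) : Set (FreeMonoid A) :=
  {x | ∀ a ∈ x, a ∈ B}

/-- The words whose set of letters is `B`. -/
def fullWords (B : Finset A) : Set (FreeMonoid A) :=
  {x | ∀ a, a ∈ x ↔ a ∈ B}

/-- The words over `B` with `k` consecutive initial factors of content `B`. -/
def manyBlocks (B : Finset A) : ℕ → Set (FreeMonoid A)
  | 0 => wordsOver B
  | k + 1 => {z | ∃ x ∈ fullWords B, ∃ y ∈ manyBlocks B k, z = x * y}

open Classical in
/-- The words over `B` whose greedy factorization into factors of content `B` has at most `k` such
factors. -/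
def fewBlocks (B : Finset A) : ℕ → Set (FreeMonoid A)
  | 0 => {x | ∃ b ∈ B, x ∈ wordsOver (B.erase b)}
  | k + 1 => fewBlocks B k ∪
      {z | ∃ b ∈ B, ∃ x ∈ wordsOver (B.erase b), ∃ y ∈ fewBlocks B k, z = x * FreeMonoid.of b * y}

theorem one_mem_wordsOver (B : Finset A) : (1 : FreeMonoid A) ∈ wordsOver B :=
  fun _ ha => absurd ha FreeMonoid.notMem_one

theorem mul_mem_wordsOver {B : Finset A} {x y : FreeMonoid A} (hx : x ∈ wordsOver B)
    (hy : y ∈ wordsOver B) : x * y ∈ wordsOver B :=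
  fun a ha => (FreeMonoid.mem_mul.1 ha).elim (hx a) (hy a)

theorem fullWords_subset (B : Finset A) : fullWords B ⊆ wordsOver B :=
  fun _ hx a ha => (hx a).1 ha

theorem mul_mem_fullWords {B : Finset A} {x y : FreeMonoid A} (hx : x ∈ fullWords B)
    (hy : y ∈ wordsOver B) : x * y ∈ fullWords B :=
  fun a => ⟨fun ha => (FreeMonoid.mem_mul.1 ha).elim (hx a).1 (hy a),
    fun ha => FreeMonoid.mem_mul.2 (Or.inl ((hx a).2 ha))⟩

open Classical in
theorem mem_wordsOver_cases {B : Finset A} {x : FreeMonoid A} (hx : x ∈ wordsOver B) :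
    x ∈ fullWords B ∨ ∃ b ∈ B, x ∈ wordsOver (B.erase b) := by
  by_cases h : ∀ b ∈ B, b ∈ x
  · exact Or.inl fun a => ⟨hx a, h a⟩
  · push Not at h
    obtain ⟨b, hb, hbx⟩ := h
    exact Or.inr ⟨b, hb, fun a ha => Finset.mem_erase.2 ⟨fun e => hbx (e ▸ ha), hx a ha⟩⟩

open Classical in
/-- A word either misses a letter of `B`, or has a shortest prefix of content `B`. -/
theorem exists_first_block {B : Finset A} (x : FreeMonoid A) (hx : x ∈ wordsOver B) :
    (∃ b ∈ B, x ∈ wordsOver (B.erase b)) ∨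
      B = ∅ ∨ ∃ b ∈ B, ∃ y ∈ wordsOver (B.erase b), ∃ z ∈ wordsOver B,
        y * FreeMonoid.of b ∈ fullWords B ∧ x = y * FreeMonoid.of b * z := by
  obtain ⟨l, rfl⟩ := FreeMonoid.ofList.surjective x
  induction l using List.reverseRecOn with
  | nil =>
    rcases B.eq_empty_or_nonempty with h | ⟨b, hb⟩
    · exact Or.inr (Or.inl h)
    · exact Or.inl ⟨b, hb, one_mem_wordsOver _⟩
  | append_singleton l a ih =>
    rw [FreeMonoid.ofList_append, FreeMonoid.ofList_singleton] at hx ⊢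
    have hl : FreeMonoid.ofList l ∈ wordsOver B :=
      fun c hc => hx c (FreeMonoid.mem_mul.2 (Or.inl hc))
    have ha : a ∈ B := hx a (FreeMonoid.mem_mul.2 (Or.inr FreeMonoid.mem_of_self))
    rcases ih hl with ⟨b, hb, hlb⟩ | h | ⟨b, hb, y, hy, z, hz, hyb, e⟩
    · rcases mem_wordsOver_cases hx with hf | h
      · refine Or.inr (Or.inr ⟨b, hb, FreeMonoid.ofList l, hlb, 1, one_mem_wordsOver _, ?_⟩)
        -- The prefix misses `b` but the extended word does not, so `b` is the letter just read.
        have hab : b = a := by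
          rcases FreeMonoid.mem_mul.1 ((hf b).2 hb) with h | h
          · exact absurd rfl (Finset.mem_erase.1 (hlb b h)).1
          · exact FreeMonoid.mem_of.1 h
        subst hab
        exact ⟨hf, (mul_one _).symm⟩
      · exact Or.inl h
    · exact Or.inr (Or.inl h)
    · refine Or.inr (Or.inr ⟨b, hb, y, hy, z * FreeMonoid.of a, mul_mem_wordsOver hz ?_, hyb, ?_⟩)
      · intro c hc
        rw [FreeMonoid.mem_of.1 hc]
        exact ha
      · rw [e, mul_assoc]

theorem one_mem_manyBlocks_empty (k : ℕ) : (1 : FreeMonoid A) ∈ manyBlocks (∅ : Finset A) k := by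
  induction k with
  | zero => exact one_mem_wordsOver _
  | succ k ih =>
    exact ⟨1, fun _ => by simp [FreeMonoid.notMem_one], 1, ih, (mul_one 1).symm⟩

theorem eq_one_of_mem_wordsOver_empty {x : FreeMonoid A} (hx : x ∈ wordsOver (∅ : Finset A)) :
    x = 1 := by
  apply FreeMonoid.toList.injective
  exact List.eq_nil_iff_forall_not_mem.2 fun a ha => by simpa using hx a ha

/-- Repeatedly remove the shortest prefix of full content: either this succeeds `k` times or the
remainder soon misses a letter. -/
theorem mem_manyBlocks_or_fewBlocks {B : Finset A} (k : ℕ) {x : FreeMonoid A}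
    (hx : x ∈ wordsOver B) : x ∈ manyBlocks B k ∨ x ∈ fewBlocks B k := by
  induction k generalizing x with
  | zero => exact Or.inl hx
  | succ k ih =>
    rcases exists_first_block x hx with h | rfl | ⟨b, hb, y, hy, z, hz, hyb, rfl⟩
    · right
      clear ih
      have h0 : x ∈ fewBlocks B 0 := h
      induction k with
      | zero => exact Or.inl h0
      | succ k ih => exact Or.inl ih
    · left
      rw [eq_one_of_mem_wordsOver_empty hx]
      exact one_mem_manyBlocks_empty _
    · rcases ih hz with h | h
      · exact Or.inl ⟨_, hyb, z, h, rfl⟩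
      · exact Or.inr (Or.inr ⟨b, hb, y, hy, z, h, rfl⟩)

/-- Cutting between the blocks gives `k + 1` prefixes, any two differing by a word of full content;
this prepares a pigeonhole argument. -/
theorem exists_prefixes {B : Finset A} (k : ℕ) {x : FreeMonoid A} (hx : x ∈ manyBlocks B k) :
    ∃ p s : ℕ → FreeMonoid A, (∀ i ≤ k, p i ∈ wordsOver B ∧ s i ∈ wordsOver B ∧ x = p i * s i) ∧
      ∀ i j, i < j → j ≤ k → ∃ u ∈ fullWords B, p j = p i * u := by
  induction k generalizing x with
  | zero =>
    refine ⟨fun _ => 1, fun _ => x, fun i _ => ⟨one_mem_wordsOver _, hx, (one_mul x).symm⟩, ?_⟩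
    intro i j hij hj
    omega
  | succ k ih =>
    obtain ⟨x, hxf, y, hy, rfl⟩ := hx
    obtain ⟨p, s, hps, hu⟩ := ih hy
    have hy0 : y ∈ wordsOver B := by
      obtain ⟨h1, h2, h3⟩ := hps 0 (Nat.zero_le _)
      rw [h3]
      exact mul_mem_wordsOver h1 h2
    refine ⟨fun i => Nat.casesOn i 1 fun i => x * p i,
      fun i => Nat.casesOn i (x * y) fun i => s i, ?_, ?_⟩
    · intro i hi
      cases i with
      | zero => exact ⟨one_mem_wordsOver _, mul_mem_wordsOver (fullWords_subset B hxf) hy0,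
          (one_mul _).symm⟩
      | succ i =>
        obtain ⟨h1, h2, h3⟩ := hps i (by omega)
        refine ⟨mul_mem_wordsOver (fullWords_subset B hxf) h1, h2, ?_⟩
        show x * y = x * p i * s i
        rw [mul_assoc, ← h3]
    · intro i j hij hj
      obtain ⟨j, rfl⟩ : ∃ j', j = j' + 1 := ⟨j - 1, by omega⟩
      cases i with
      | zero =>
        exact ⟨x * p j, mul_mem_fullWords hxf (hps j (by omega)).1, (one_mul _).symm⟩
      | succ i =>
        obtain ⟨u, huf, hu⟩ := hu i j (by omega) (by omega)
        refine ⟨u, huf, ?_⟩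
        show x * p j = x * p i * u
        rw [hu, mul_assoc]

/-- In a finite quotient, a word with sufficiently many blocks of content `B` has a factor that is
an `ω`-power of a word of content `B`. -/
theorem exists_proj_eq_omega (c : FinCon A) (B : Finset A) :
    ∃ k : ℕ, ∀ x ∈ manyBlocks B k, ∃ p ∈ wordsOver B, ∃ u ∈ fullWords B, ∃ s ∈ wordsOver B,
      proj c (ofWord x) = proj c (ofWord p * (ofWord u).omega * ofWord s) := by
  -- With as many blocks as elements there is one more prefix than elements, so two prefixes
  -- coincide in the quotient.
  refine ⟨Nat.card c.1.Quotient, fun x hx => ?_⟩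
  obtain ⟨p, s, hps, hu⟩ := exists_prefixes _ hx
  have hni : ¬ Function.Injective fun i : Fin (Nat.card c.1.Quotient + 1) =>
      proj c (ofWord (p i)) := by
    intro hinj
    have h := Nat.card_le_card_of_injective _ hinj
    rw [Nat.card_fin] at h
    omega
  obtain ⟨i, j, hij, hlt⟩ : ∃ i j : Fin (Nat.card c.1.Quotient + 1),
      proj c (ofWord (p i)) = proj c (ofWord (p j)) ∧ i < j := by
    simp only [Function.Injective, not_forall] at hni
    obtain ⟨i, j, h, hne⟩ := hni
    rcases lt_or_gt_of_ne hne with h' | h'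
    · exact ⟨i, j, h, h'⟩
    · exact ⟨j, i, h.symm, h'⟩
  obtain ⟨u, huf, hpu⟩ := hu i j hlt (by omega)
  obtain ⟨h1, h2, h3⟩ := hps i (by omega)
  refine ⟨p i, h1, u, huf, s i, h2, ?_⟩
  rw [hpu, map_mul, map_mul] at hij
  -- The coincidence says that `u` stabilizes the prefix, so `u^ω` can be inserted after it.
  have hpow : ∀ n : ℕ, proj c (ofWord (p i)) * proj c (ofWord u) ^ n =
      proj c (ofWord (p i)) := by
    intro n
    induction n with
    | zero => simp
    | succ n ih => rw [pow_succ, ← mul_assoc, ih, ← hij]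
  obtain ⟨n, -, hn, -⟩ := exists_omegaPow_eq_pow (proj c (ofWord u)) (proj c (ofWord u))
  rw [h3]
  simp only [map_mul, proj_omega]
  rw [hn, hpow]

/-! ## Countability of the quotient -/

/-- The submonoid generated by the letters and the `ω`-powers of words. -/
noncomputable def omegaWords (A : Type) : Submonoid (Pseudoword A) :=
  Submonoid.closure (Set.range of ∪ Set.range fun u : FreeMonoid A => (ofWord u).omega)

instance [Finite A] : Countable (FreeMonoid A) :=
  inferInstanceAs (Countable (List A))

instance [Finite A] : Countable (omegaWords A) := by
  have hs : (Set.range of ∪ Set.range fun u : FreeMonoid A => (ofWord u).omega :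
      Set (Pseudoword A)).Countable := (Set.countable_range _).union (Set.countable_range _)
  have := hs.to_subtype
  have h : Countable (FreeMonoid (Set.range of ∪ Set.range fun u : FreeMonoid A =>
      (ofWord u).omega : Set (Pseudoword A))) := inferInstanceAs (Countable (List _))
  unfold omegaWords
  rw [Submonoid.closure_eq_mrange]
  exact (MonoidHom.mrangeRestrict_surjective _).countable

section Countability

variable {R : Con (Pseudoword A)}
  (hR : IsClosed {p : Pseudoword A × Pseudoword A | R p.1 p.2})
  (hl : ∀ x y : Pseudoword A, R ((x * y).omega * x) (x * y).omega)
  (hr : ∀ x y : Pseudoword A, R (x * y).omega (y * (x * y).omega))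

include hR hl hr in
-- In each finite quotient `w` looks like `p u^ω s`; `u^ω` absorbs `p` and `s`, and only the content
-- of `u` matters.
theorem rel_omega_of_manyBlocks {B : Finset A} {v : FreeMonoid A} (hv : v ∈ fullWords B)
    {w : Pseudoword A} (hw : ∀ k, w ∈ closure (ofWord '' manyBlocks B k)) :
    R w (ofWord v).omega := by
  refine mem_of_isClosed_of_proj (u := w) (v := (ofWord v).omega) hR fun c => ?_
  obtain ⟨k, hk⟩ := exists_proj_eq_omega c B
  obtain ⟨_, ⟨x, hx, rfl⟩, hxw⟩ := mem_closure_iff_proj.1 (hw k) c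
  obtain ⟨p, hp, u, hu, s, hs, e⟩ := hk x hx
  refine ⟨(ofWord p * (ofWord u).omega * ofWord s, (ofWord v).omega), ?_, ?_, rfl⟩
  · have h1 := (rel_omega_absorb_word hl hr p fun a ha => (hu a).2 (hp a ha)).2
    have h2 := (rel_omega_absorb_word hl hr s fun a ha => (hu a).2 (hs a ha)).1
    have h3 := rel_omega_omega hR hl hr (u := u) (v := v) fun a => (hu a).trans (hv a).symm
    exact R.trans (R.mul h1 (R.refl _)) (R.trans h2 h3)
  · exact e.symm.trans hxw

open Classical in
-- By compactness, products of closed sets are closed. A limit of such words therefore factors in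
-- the same way, into letters and limits over alphabets missing a letter.
theorem exists_rel_of_fewBlocks {B : Finset A}
    (hB : ∀ b ∈ B, ∀ w ∈ closure (ofWord '' wordsOver (B.erase b)), ∃ s ∈ omegaWords A, R w s)
    (k : ℕ) {w : Pseudoword A} (hw : w ∈ closure (ofWord '' fewBlocks B k)) :
    ∃ s ∈ omegaWords A, R w s := by
  induction k generalizing w with
  | zero =>
    have e : ofWord '' fewBlocks B 0 = ⋃ b ∈ B, ofWord '' wordsOver (B.erase b) := by
      ext z
      simp only [fewBlocks, Set.mem_image, Set.mem_iUnion]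
      constructor
      · rintro ⟨x, ⟨b, hb, hx⟩, rfl⟩
        exact ⟨b, hb, x, hx, rfl⟩
      · rintro ⟨b, hb, x, hx, rfl⟩
        exact ⟨x, ⟨b, hb, hx⟩, rfl⟩
    rw [e, Finset.closure_biUnion] at hw
    simp only [Set.mem_iUnion] at hw
    obtain ⟨b, hb, hw⟩ := hw
    exact hB b hb w hw
  | succ k ih =>
    have hcl : IsClosed (⋃ b ∈ B, (fun p : Pseudoword A × Pseudoword A => p.1 * of b * p.2) ''
        (closure (ofWord '' wordsOver (B.erase b)) ×ˢ closure (ofWord '' fewBlocks B k))) := by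
      refine isClosed_biUnion_finset fun b _ => IsCompact.isClosed ?_
      exact (isClosed_closure.isCompact.prod isClosed_closure.isCompact).image (by fun_prop)
    have hsub : ofWord '' fewBlocks B (k + 1) ⊆ closure (ofWord '' fewBlocks B k) ∪
        ⋃ b ∈ B, (fun p : Pseudoword A × Pseudoword A => p.1 * of b * p.2) ''
          (closure (ofWord '' wordsOver (B.erase b)) ×ˢ closure (ofWord '' fewBlocks B k)) := by
      rintro _ ⟨z, hz | ⟨b, hb, x, hx, y, hy, rfl⟩, rfl⟩
      · exact Or.inl (subset_closure ⟨z, hz, rfl⟩)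
      · refine Or.inr (Set.mem_iUnion₂.2 ⟨b, hb, (ofWord x, ofWord y),
          ⟨subset_closure ⟨x, hx, rfl⟩, subset_closure ⟨y, hy, rfl⟩⟩, ?_⟩)
        simp only [map_mul, ofWord_of]
    rcases closure_minimal hsub (isClosed_closure.union hcl) hw with h | h
    · exact ih h
    · obtain ⟨b, hb, ⟨x, y⟩, ⟨hx, hy⟩, rfl⟩ := Set.mem_iUnion₂.1 h
      obtain ⟨s, hs, hxs⟩ := hB b hb x hx
      obtain ⟨t, ht, hyt⟩ := ih hy
      have hb' : of b ∈ omegaWords A := Submonoid.subset_closure (Or.inl ⟨b, rfl⟩)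
      exact ⟨s * of b * t, mul_mem (mul_mem hs hb') ht,
        R.mul (R.mul hxs (R.refl _)) hyt⟩

include hR hl hr in
-- Induction on the content: a limit of words with boundedly many blocks reduces to smaller
-- alphabets; otherwise it is in the closure of `manyBlocks B k` for every `k`, hence an `ω`-power
-- modulo `R`.
theorem exists_rel_of_mem_closure (B : Finset A) {w : Pseudoword A}
    (hw : w ∈ closure (ofWord '' wordsOver B)) : ∃ s ∈ omegaWords A, R w s := by
  classical
  induction B using Finset.strongInduction generalizing w with
  | H B ih =>
    by_cases h : ∃ k, w ∈ closure (ofWord '' fewBlocks B k)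
    · obtain ⟨k, hk⟩ := h
      exact exists_rel_of_fewBlocks
        (fun b hb w hw => ih (B.erase b) (Finset.erase_ssubset hb) hw) k hk
    · push Not at h
      have hv : FreeMonoid.ofList B.toList ∈ fullWords B := fun a => Finset.mem_toList
      refine ⟨_, Submonoid.subset_closure (Or.inr ⟨FreeMonoid.ofList B.toList, rfl⟩),
        rel_omega_of_manyBlocks hR hl hr hv fun k => ?_⟩
      have hsub : ofWord '' wordsOver B ⊆ ofWord '' manyBlocks B k ∪ ofWord '' fewBlocks B k := by
        rintro _ ⟨x, hx, rfl⟩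
        exact (mem_manyBlocks_or_fewBlocks k hx).imp (fun h => ⟨x, h, rfl⟩) fun h => ⟨x, h, rfl⟩
      have h1 := closure_mono hsub hw
      rw [closure_union] at h1
      exact h1.resolve_right (h k)

include hR hl hr in
theorem countable_quotient [Finite A] : Countable (Quotient R.toSetoid) := by
  have := Fintype.ofFinite A
  refine Function.Surjective.countable
    (f := fun s : omegaWords A => (Quotient.mk R.toSetoid s.1)) fun q => ?_
  obtain ⟨w, rfl⟩ := Quotient.mk_surjective q
  have hw : w ∈ closure (ofWord '' wordsOver (Finset.univ : Finset A)) := by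
    rw [mem_closure_iff_proj]
    intro c
    obtain ⟨x, hx⟩ := exists_word c w
    exact ⟨_, ⟨x, fun a _ => Finset.mem_univ a, rfl⟩, hx.symm⟩
  obtain ⟨s, hs, hws⟩ := exists_rel_of_mem_closure hR hl hr _ hw
  exact ⟨⟨s, hs⟩, Quotient.sound (R.symm hws)⟩

end Countability

/-! ## Separation by finite monoids -/

/-- The syntactic congruence of a set of pseudowords. -/
def syntacticCon (U : Set (Pseudoword A)) : Con (Pseudoword A) where
  r x y := ∀ p s, p * x * s ∈ U ↔ p * y * s ∈ U
  iseqv := ⟨fun _ _ _ => Iff.rfl, fun h p s => (h p s).symm,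
    fun h h' p s => (h p s).trans (h' p s)⟩
  mul' := by
    intro x y z w h h' p s
    have h1 := h p (z * s)
    have h2 := h' (p * y) s
    simp only [mul_assoc] at h1 h2 ⊢
    exact h1.trans h2

/-- A clopen set of pseudowords is recognized by a finite quotient. -/
theorem exists_recognizing {U : Set (Pseudoword A)} (hU : IsClopen U) :
    ∃ c : FinCon A, ∀ x y, proj c x = proj c y → (x ∈ U ↔ y ∈ U) := by
  have hloc : ∀ u : Pseudoword A, ∃ c : FinCon A, ∀ v, proj c v = proj c u →
      (v ∈ U ↔ u ∈ U) := by
    intro u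
    by_cases hu : u ∈ U
    · obtain ⟨c, hc⟩ := exists_proj_subset hU.isOpen hu
      exact ⟨c, fun v hv => iff_of_true (hc v hv) hu⟩
    · obtain ⟨c, hc⟩ := exists_proj_subset hU.compl.isOpen hu
      exact ⟨c, fun v hv => iff_of_false (hc v hv) hu⟩
  choose f hf using hloc
  classical
  -- Finitely many local quotients cover the space; a common refinement recognizes `U`.
  obtain ⟨t, -, ht⟩ := isCompact_univ.elim_nhds_subcover
    (fun u => {v : Pseudoword A | proj (f u) v = proj (f u) u})
    fun u _ => (isClopen_proj (f u) (proj (f u) u)).isOpen.mem_nhds rfl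
  obtain ⟨e, he⟩ := exists_le_forall (t.image f)
  refine ⟨e, fun x y hxy => ?_⟩
  obtain ⟨u, hu, hxu⟩ := Set.mem_iUnion₂.1 (ht (Set.mem_univ x))
  have hle := he (f u) (Finset.mem_image_of_mem f hu)
  have hyu : proj (f u) y = proj (f u) u := (proj_eq_of_le hle hxy).symm.trans hxu
  exact (hf u x hxu).trans (hf u y hyu).symm

/-- Let `R` be a closed congruence that is closed under the instances of the pseudoidentities in
`S` and identifies `(xy)^ω x`, `(xy)^ω` and `y (xy)^ω`. Then `R` contains every pseudoidentity
that holds in the finite models of `S`. -/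
theorem rel_of_forall_models [Finite A] {S : Set Pseudoidentity} {R : Con (Pseudoword A)}
    (hR : IsClosed {p : Pseudoword A × Pseudoword A | R p.1 p.2})
    (hl : ∀ x y : Pseudoword A, R ((x * y).omega * x) (x * y).omega)
    (hr : ∀ x y : Pseudoword A, R (x * y).omega (y * (x * y).omega))
    (hS : ∀ p ∈ S, ∀ f : p.alphabet → Pseudoword A, R (extend f p.lhs) (extend f p.rhs))
    {u v : Pseudoword A}
    (huv : ∀ (T : Type) [Monoid T] [Finite T], Models T S → HoldsIn T u v) : R u v := by
  by_contra hne
  have := countable_quotient hR hl hr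
  obtain ⟨U, hU, hsat, huU, hvU⟩ := exists_isClopen_saturated R.toSetoid hR hne
  obtain ⟨c, hc⟩ := exists_recognizing hU
  let σ := syntacticCon U
  have hproj : ∀ x y, proj c x = proj c y → Con.mk' σ x = Con.mk' σ y := by
    intro x y hxy
    refine (Con.eq σ).2 fun p s => hc _ _ ?_
    simp only [map_mul, hxy]
  -- The syntactic congruence is coarser than the kernel of `proj c`, so it has finite index.
  have hfin : Finite σ.Quotient := by
    refine Finite.of_injective (fun t : σ.Quotient => proj c (Function.surjInv
      (Con.mk'_surjective (c := σ)) t)) fun s t hst => ?_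
    have h := hproj _ _ hst
    rwa [Function.surjInv_eq Con.mk'_surjective, Function.surjInv_eq Con.mk'_surjective] at h
  -- Since `U` is `R`-saturated, `R`-equivalent elements have the same contexts in `U`.
  have hRσ : ∀ x y, R x y → Con.mk' σ x = Con.mk' σ y := by
    intro x y hxy
    have key : ∀ x y, R x y → ∀ p s, p * x * s ∈ U → p * y * s ∈ U := fun x y hxy p s h =>
      hsat _ _ (R.mul (R.mul (R.refl p) hxy) (R.refl s)) h
    exact (Con.eq σ).2 fun p s => ⟨key x y hxy p s, key y x (R.symm hxy) p s⟩
  have hmodels : Models σ.Quotient S := by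
    intro p hp φ
    -- Lifting an assignment to pseudowords turns evaluation into a substitution instance, to which
    -- `R` applies.
    obtain ⟨f, hf⟩ : ∃ f : p.alphabet → Pseudoword A, ∀ b, Con.mk' σ (f b) = φ b :=
      ⟨fun b => Function.surjInv (Con.mk'_surjective (c := σ)) (φ b),
        fun b => Function.surjInv_eq _ _⟩
    have heval : ∀ w, eval φ w = Con.mk' σ (extend f w) := by
      intro w
      have h := eval_eq_of_proj ((Con.mk' σ).comp (extend f)) (kerFin fun b => proj c (f b))
        (fun x y hxy => hproj _ _ (eval_proj _ hxy)) w
      simp only [MonoidHom.comp_apply, extend_of, hf] at h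
      exact h
    rw [heval, heval]
    exact hRσ _ _ (hS p hp f)
  have h := huv σ.Quotient hmodels fun a => Con.mk' σ (of a)
  rw [eval_eq_of_proj (Con.mk' σ) c hproj, eval_eq_of_proj (Con.mk' σ) c hproj] at h
  have h1 := (Con.eq σ).1 h 1 1
  simp only [one_mul, mul_one] at h1
  exact hvU (h1.1 huU)

end Pseudoword

/-! ### The two sets are h-strong -/

open Pseudoword

theorem hStrong_sigmaJ : HStrong sigmaJ := by
  intro A _ u v huv
  have hne : sigmaJ.Nonempty := ⟨_, Or.inl rfl⟩
  have h1 : ∀ z : Pseudoword A, provableCon sigmaJ hne A (z.omega * z) z.omega := by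
    intro z
    have h := provable_extend (S := sigmaJ) (Or.inl rfl) fun _ => z
    simp only [map_mul, extend_omega, extend_of] at h
    exact h
  have h2 : ∀ x y : Pseudoword A,
      provableCon sigmaJ hne A (x * y).omega (y * x).omega := by
    intro x y
    have h := provable_extend (S := sigmaJ) (Or.inr rfl) ![x, y]
    simp only [letterX, letterY, map_mul, extend_omega, extend_of] at h
    exact h
  have hR := isClosed_provable sigmaJ A
  exact rel_of_forall_models (R := provableCon sigmaJ hne A) hR (rel_omega_mul_left hR h1 h2)
    (rel_omega_mul_right hR h1 h2) (fun p hp f => provable_extend hp f) huv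

theorem hStrong_gammaJ : HStrong gammaJ := by
  intro A _ u v huv
  have hne : gammaJ.Nonempty := ⟨_, Or.inl rfl⟩
  have h1 : ∀ x y : Pseudoword A,
      provableCon gammaJ hne A ((x * y).omega * x) (x * y).omega := by
    intro x y
    have h := provable_extend (S := gammaJ) (Or.inl rfl) ![x, y]
    simp only [letterX, letterY, map_mul, extend_omega, extend_of] at h
    exact h
  have h2 : ∀ x y : Pseudoword A,
      provableCon gammaJ hne A (x * y).omega (y * (x * y).omega) := by
    intro x y
    have h := provable_extend (S := gammaJ) (Or.inr rfl) ![x, y]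
    simp only [letterX, letterY, map_mul, extend_omega, extend_of] at h
    exact h
  exact rel_of_forall_models (R := provableCon gammaJ hne A) (isClosed_provable gammaJ A) h1 h2
    (fun p hp f => provable_extend hp f) huv

/-- The two sets of pseudoidentities define the pseudovariety of finite `J`-trivial monoids, and
both are h-strong within the pseudovariety of all finite monoids. -/
theorem theoremt :
    (∀ (T : Type) [Monoid T] [Finite T], Models T sigmaJ ↔ IsJTrivial T) ∧
    (∀ (T : Type) [Monoid T] [Finite T], Models T gammaJ ↔ IsJTrivial T) ∧
    HStrong sigmaJ ∧ HStrong gammaJ :=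
  ⟨models_sigmaJ_iff_isJTrivial, models_gammaJ_iff_isJTrivial, hStrong_sigmaJ, hStrong_gammaJ⟩
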